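/- Let $X$ be a metric space. A segment with endpoints $x,y\in X$ is a subset of $X$ that is the image of a compact interval of the real line under an isometric embedding sending the ends of the interval to $x$ and $y$. A set $A\subset X$ is convex if it contains all segments with endpoints in $A$. The space $X$ is uniquely geodesic if for all $x,y\in X$ there is a unique segment $[xy]$ with endpoints $x$ and $y$, and $[xy]$ depends continuously on $x$ and $y$ (with respect to the Hausdorff distance). The compact topological dimension of $X$ is $\dim_c X=\sup\{\dim K : K\subset X \text{ compact}\}$, where $\dim$ is the Lebesgue covering dimension ($\dim\emptyset=-1$). Theorem. Let $X$ be a uniquely geodesic space with $\dim_c X=n$, where $0\le n<\infty$. Let $\{A_i\}$ be a finite family of convex sets in $X$ (not necessarily open or closed) such that every subfamily of at most $n+1$ of them has nonempty intersection. Then $\bigcap_i A_i\neq\emptyset$. Moreover, every CAT(0) space (not necessarily complete) is uniquely geodesic in the above sense, so the theorem covers CAT(0) spaces in particular. -/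

import Mathlib

open Filter Topology

namespace Helly

section Geodesic

variable {X : Type*} [MetricSpace X]

/-- `S` is a segment with endpoints `x` and `y`: the isometric image of a compact interval
`[0, l]` of the real line, whose ends `0` and `l` are mapped to `x` and `y`. -/
def IsSegment (x y : X) (S : Set X) : Prop :=
  ∃ l : ℝ, 0 ≤ l ∧ ∃ γ : ℝ → X,
    (∀ s ∈ Set.Icc 0 l, ∀ t ∈ Set.Icc 0 l, dist (γ s) (γ t) = |s - t|) ∧
      γ 0 = x ∧ γ l = y ∧ γ '' Set.Icc 0 l = S

/-- A set is convex if it contains all segments with endpoints in it. -/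
def IsGeodesicallyConvex (A : Set X) : Prop :=
  ∀ x ∈ A, ∀ y ∈ A, ∀ S : Set X, IsSegment x y S → S ⊆ A

variable (X)

/-- Any two points `x, y` are the endpoints of exactly one segment `seg x y`, and `seg x y`
depends continuously on `x` and `y`, with respect to the Hausdorff distance. -/
def IsUniquelyGeodesic : Prop :=
  ∃ seg : X → X → Set X,
    (∀ (x y : X) (S : Set X), IsSegment x y S ↔ S = seg x y) ∧
    ∀ x y : X, Tendsto (fun p : X × X => Metric.hausdorffDist (seg p.1 p.2) (seg x y))
      (𝓝 (x, y)) (𝓝 0)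

/-- CAT(0) spaces: geodesic spaces in which every geodesic triangle is at least as thin as its
comparison triangle `p' q' r'` in the Euclidean plane. Here `x` and `y` lie on two sides of the
triangle, `p` is the common vertex of these sides, and `x'`, `y'` are the comparison points
(for two points of one side the comparison inequality is trivial). -/
def IsCATZero : Prop :=
  (∀ x y : X, ∃ S : Set X, IsSegment x y S) ∧
  ∀ (p q r : X) (S T : Set X), IsSegment p q S → IsSegment p r T →
    ∀ x ∈ S, ∀ y ∈ T, ∀ p' q' r' x' y' : EuclideanSpace ℝ (Fin 2),
      dist p' q' = dist p q → dist p' r' = dist p r → dist q' r' = dist q r →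
      dist p' x' = dist p x → dist x' q' = dist x q →
      dist p' y' = dist p y → dist y' r' = dist y r →
      dist x y ≤ dist x' y'

end Geodesic

section Dimension

/-- Every open cover of `Y` has an open refinement (again a cover) of multiplicity at most `k`,
i.e. every point of `Y` is in at most `k` members of it. -/
def HasRefinementsOfMultiplicityLE (Y : Type*) [TopologicalSpace Y] (k : ℕ) : Prop :=
  ∀ U : Set (Set Y), (∀ u ∈ U, IsOpen u) → ⋃₀ U = Set.univ →
    ∃ V : Set (Set Y), (∀ v ∈ V, IsOpen v) ∧ ⋃₀ V = Set.univ ∧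
      (∀ v ∈ V, ∃ u ∈ U, v ⊆ u) ∧ ∀ y : Y, {v ∈ V | y ∈ v}.encard ≤ k

/-- The Lebesgue covering dimension: the least `d` such that every open cover has an open
refinement of multiplicity at most `d + 1`. It is `⊥` (standing for `-1`) for the empty space,
and `⊤` if there is no such finite `d`. The condition says that refinements of multiplicity at
most `k` exist for every natural number `k` with `d + 1 ≤ k`, that is, `d < k`. -/
noncomputable def coveringDim (Y : Type*) [TopologicalSpace Y] : WithBot ℕ∞ :=
  sInf {d : WithBot ℕ∞ |
    ∀ k : ℕ, d < ((k : ℕ∞) : WithBot ℕ∞) → HasRefinementsOfMultiplicityLE Y k}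

/-- The compact topological dimension: the supremum of the covering dimensions of the compact
subsets. -/
noncomputable def compactTopDim (X : Type*) [TopologicalSpace X] : WithBot ℕ∞ :=
  ⨆ (K : Set X) (_ : IsCompact K), coveringDim K

end Dimension

end Helly

/-! By induction on the number of sets it suffices to treat `N + 1` convex sets `A i`, `N ≥ n + 1`,
any `N` of which meet. Pick `p i` in all `A j` with `j ≠ i`. Continuous joins along segments give a
map `g` from the `N`-cube to `X`, a singular simplex with vertices `p i` in cubical coordinates. On
the part `Z i` of the boundary where `p i` plays no role, `g` takes values in `A i`. The compact
sets `g '' Z i ⊆ A i` replace the `A i`, so no closedness is needed.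

If these compact sets had no common point, their complements would cover the image of the cube. A
refinement of multiplicity at most `n + 1 ≤ N`, grouped into `N + 1` classes and shrunk to closed
sets, would contradict the cubical KKM lemma `exists_mem_iInter_of_closed_cover_cube`, which follows
from Kuhn's form of Sperner's lemma.

For CAT(0) spaces, comparison bounds the distance between proportional points of two sides by the
third side; this gives uniqueness and continuity of segments. -/

namespace Helly

/-! ### Combinatorics: Kuhn's cubical Sperner lemma and a cubical KKM lemma. -/

section Sperner

open Finset

/-- The vertices, in decreasing order, of the Freudenthal simplex in the unit cube based at `v`
given by the order `σ` of the coordinates. -/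
def kuhnVertex {N : ℕ} (v : Fin N → ℕ) (σ : Equiv.Perm (Fin N)) (i : Fin (N + 1)) : Fin N → ℕ :=
  fun j => v j + if i.val ≤ (σ j).val then 1 else 0

open Classical in
/-- The indicator mod 2 of the labels `0, …, N` all occurring in `a`. -/
noncomputable def rainbow {N : ℕ} (a : Fin (N + 1) → ℕ) : ZMod 2 :=
  if ∀ j ≤ N, ∃ i, a i = j then 1 else 0

open Classical in
/-- The indicator mod 2 of the labels `1, …, N` all occurring in `a` outside the index `i`. -/
noncomputable def rainbowFacet {N : ℕ} (a : Fin (N + 1) → ℕ) (i : Fin (N + 1)) : ZMod 2 :=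
  if ∀ j, 1 ≤ j → j ≤ N → ∃ i', i' ≠ i ∧ a i' = j then 1 else 0

/-- The usual Sperner parity count: a fully labelled simplex has exactly one facet carrying `1, …,
N`, namely the one opposite its label `0`; any other simplex has none or two. -/
theorem rainbow_eq_sum_rainbowFacet {N : ℕ} (a : Fin (N + 1) → ℕ) (ha : ∀ i, a i ≤ N) :
    rainbow a = ∑ i, rainbowFacet a i := by
  classical
  by_cases hfull : ∀ j ≤ N, ∃ i, a i = j
  · have hsurj : Function.Surjective
        (fun i => (⟨a i, Nat.lt_succ_of_le (ha i)⟩ : Fin (N + 1))) := by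
      intro j
      obtain ⟨i, hi⟩ := hfull j (Nat.le_of_lt_succ j.2)
      exact ⟨i, Fin.ext hi⟩
    have hinj := Finite.injective_iff_surjective.2 hsurj
    have hinj' : ∀ i i', a i = a i' → i = i' := fun i i' h => hinj (Fin.ext h)
    obtain ⟨i₀, hi₀⟩ := hfull 0 (Nat.zero_le _)
    rw [rainbow, if_pos hfull, Finset.sum_eq_single i₀]
    · rw [rainbowFacet, if_pos]
      intro j h1 hj
      obtain ⟨i, hi⟩ := hfull j hj
      refine ⟨i, ?_, hi⟩
      rintro rfl
      omega
    · intro i _ hne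
      rw [rainbowFacet, if_neg]
      intro h
      have hpos : a i ≠ 0 := fun h0 => hne (hinj' _ _ (h0.trans hi₀.symm))
      obtain ⟨i', hi', he⟩ := h (a i) (Nat.one_le_iff_ne_zero.2 hpos) (ha i)
      exact hi' (hinj' _ _ he)
    · simp
  · rw [rainbow, if_neg hfull]
    by_cases hgood : ∃ i₀, ∀ j, 1 ≤ j → j ≤ N → ∃ i', i' ≠ i₀ ∧ a i' = j
    · obtain ⟨i₀, h₀⟩ := hgood
      have hpos : 1 ≤ a i₀ := by
        by_contra hlt
        apply hfull
        intro j hj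
        rcases Nat.eq_zero_or_pos j with rfl | hj0
        · exact ⟨i₀, by omega⟩
        · obtain ⟨i', -, h⟩ := h₀ j hj0 hj
          exact ⟨i', h⟩
      -- The label of `i₀` is repeated at `i₁`; dropping either of the two vertices leaves `1, …,
      -- N`, and no other omission does.
      obtain ⟨i₁, hne, h₁⟩ := h₀ (a i₀) hpos (ha i₀)
      rw [← Finset.sum_subset (Finset.subset_univ {i₀, i₁}), Finset.sum_pair hne.symm,
        rainbowFacet, rainbowFacet, if_pos h₀, if_pos]
      · decide
      · intro j hj hjN
        obtain ⟨i', hi', h⟩ := h₀ j hj hjN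
        by_cases hc : i' = i₁
        · exact ⟨i₀, hne.symm, by rw [← h₁, ← hc, h]⟩
        · exact ⟨i', hc, h⟩
      · intro i _ hi
        simp only [Finset.mem_insert, Finset.mem_singleton, not_or] at hi
        rw [rainbowFacet, if_neg]
        intro h
        have hsub : Finset.Icc 1 N ⊆ ((Finset.univ.erase i).erase i₀).image a := by
          intro j hj
          rw [Finset.mem_Icc] at hj
          obtain ⟨i', hi', he⟩ := h j hj.1 hj.2
          rw [Finset.mem_image]
          by_cases hc : i' = i₀
          · exact ⟨i₁, by simp [hne, Ne.symm hi.2], by rw [h₁, ← hc, he]⟩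
          · exact ⟨i', by simp [hi', hc], he⟩
        have hcard := (Finset.card_le_card hsub).trans Finset.card_image_le
        rw [Nat.card_Icc, Finset.card_erase_of_mem (by simp [Ne.symm hi.1]),
          Finset.card_erase_of_mem (Finset.mem_univ _), Finset.card_univ, Fintype.card_fin] at hcard
        have : (Finset.Icc 1 N).Nonempty := ⟨a i₀, by simp [hpos, ha]⟩
        rw [Finset.nonempty_Icc] at this
        omega
    · push Not at hgood
      symm
      apply Finset.sum_eq_zero
      intro i _
      rw [rainbowFacet, if_neg]
      push Not
      exact hgood i

/-- Exchanging the positions `i - 1` and `i` in the order of coordinates moves only vertex `i`. Thus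
simplices of one cube are paired along the facets opposite vertex `i`. -/
theorem sum_rainbowFacet_interior {N : ℕ} (L : (Fin N → ℕ) → ℕ) (v : Fin N → ℕ) (i : Fin (N + 1))
    (h0 : 0 < i.val) (hN : i.val < N) :
    ∑ σ, rainbowFacet (fun l => L (kuhnVertex v σ l)) i = 0 := by
  have hne : (⟨i - 1, by omega⟩ : Fin N) ≠ ⟨i, hN⟩ := by
    simp only [ne_eq, Fin.mk.injEq]; omega
  let s : Equiv.Perm (Fin N) := Equiv.swap ⟨i - 1, by omega⟩ ⟨i, hN⟩
  have hs : s ≠ 1 := fun h => hne (Equiv.swap_eq_one_iff.1 h)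
  refine Finset.sum_involution (fun σ _ => s * σ) ?_ ?_ (by simp) ?_
  · intro σ _
    have hv : ∀ l, l ≠ i → kuhnVertex v (s * σ) l = kuhnVertex v σ l := by
      intro l hl
      have hl' : l.val ≠ i.val := fun h => hl (Fin.ext h)
      funext j
      simp only [kuhnVertex, Equiv.Perm.mul_apply, s, Equiv.swap_apply_def]
      split_ifs <;> simp_all [Fin.ext_iff] <;> omega
    have : rainbowFacet (fun l => L (kuhnVertex v (s * σ) l)) i
        = rainbowFacet (fun l => L (kuhnVertex v σ l)) i := by
      unfold rainbowFacet
      congr 1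
      apply propext
      refine forall_congr' fun j => imp_congr_right fun _ => imp_congr_right fun _ =>
        exists_congr fun l => and_congr_right fun hl => ?_
      simp only [hv l hl]
    rw [this]
    exact CharTwo.add_self_eq_zero _
  · intro σ _ _ h
    exact hs (mul_eq_right.1 h)
  · intro σ _
    simp [s, ← mul_assoc]

/-- The facet opposite the last vertex lies in an upper face of the cube, so it is also a facet of
the adjacent cube, there opposite vertex `0`; the order of the coordinates is rotated. -/
theorem rainbowFacet_last_eq {M : ℕ} (L : (Fin (M + 1) → ℕ) → ℕ) (v : Fin (M + 1) → ℕ)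
    (σ : Equiv.Perm (Fin (M + 1))) :
    rainbowFacet (fun l => L (kuhnVertex v σ l)) (Fin.last (M + 1)) =
      rainbowFacet (fun l => L (kuhnVertex (v + Pi.single ((finRotate (M + 1) * σ).symm 0) 1)
        (finRotate (M + 1) * σ) l)) 0 := by
  have hk : (finRotate (M + 1) * σ).symm 0 = σ.symm (Fin.last M) := by
    rw [Equiv.symm_apply_eq]
    simp
  have hv : ∀ i : Fin (M + 1), kuhnVertex v σ i.castSucc =
      kuhnVertex (v + Pi.single (σ.symm (Fin.last M)) 1) (finRotate (M + 1) * σ) i.succ := by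
    intro i
    funext j
    by_cases hj : j = σ.symm (Fin.last M)
    · subst hj
      have := Nat.le_of_lt_succ i.2
      simp [kuhnVertex, this]
    · have hj' : σ j ≠ Fin.last M := fun h => hj (by rw [← h]; simp)
      have : ((finRotate (M + 1)) (σ j)).val = (σ j).val + 1 := by
        rw [coe_finRotate, if_neg hj']
      simp only [kuhnVertex, Equiv.Perm.mul_apply, this, Pi.add_apply, Pi.single_eq_of_ne hj,
        Fin.val_castSucc, Fin.val_succ, add_le_add_iff_right, add_zero]
  unfold rainbowFacet
  congr 1
  apply propext
  rw [hk]
  refine forall_congr' fun j => imp_congr_right fun _ => imp_congr_right fun _ => ?_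
  constructor
  · rintro ⟨i, hi, h⟩
    obtain ⟨i, rfl⟩ := Fin.exists_castSucc_eq.2 hi
    exact ⟨i.succ, Fin.succ_ne_zero _, by simpa only [hv] using h⟩
  · rintro ⟨i, hi, h⟩
    obtain ⟨i, rfl⟩ := Fin.exists_succ_eq.2 hi
    exact ⟨i.castSucc, (Fin.castSucc_lt_last i).ne, by simpa only [hv] using h⟩

/-- Mod 2 the sum telescopes in direction `k`: the shifted terms cancel the unshifted ones except on
the bottom layer, and `hg` kills the top layer. -/
theorem sum_add_shift {N m : ℕ} (k : Fin N) (g : (Fin N → ℕ) → ZMod 2)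
    (hg : ∀ v : Fin N → ℕ, v k = m + 1 → (∀ j, j ≠ k → v j ≤ m) → g v = 0) :
    ∑ v : Fin N → Fin (m + 1), (g (fun j => v j) + g ((fun j => (v j : ℕ)) + Pi.single k 1)) =
      ∑ v : Fin N → Fin (m + 1), if v k = 0 then g (fun j => v j) else 0 := by
  let e : (Fin N → Fin (m + 1)) ≃ (Fin N → Fin (m + 1)) :=
    Equiv.piCongrRight fun j => if j = k then finRotate (m + 1) else Equiv.refl _
  have hek : ∀ v, e v k = finRotate (m + 1) (v k) := fun v => by simp [e]
  have hej : ∀ v j, j ≠ k → e v j = v j := fun v j hj => by simp [e, hj]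
  have key : ∑ v : Fin N → Fin (m + 1), g ((fun j => (v j : ℕ)) + Pi.single k 1) =
      ∑ v : Fin N → Fin (m + 1), if v k = 0 then 0 else g (fun j => v j) := by
    refine Fintype.sum_equiv e _ _ fun v => ?_
    by_cases hl : v k = Fin.last m
    · rw [if_pos (by rw [hek, hl]; simp)]
      apply hg
      · simp [hl]
      · intro j hj
        simpa [hj] using Nat.le_of_lt_succ (v j).2
    · have h1 : (finRotate (m + 1) (v k) : ℕ) = v k + 1 := by rw [coe_finRotate, if_neg hl]
      rw [if_neg]
      · congr 1
        funext j
        by_cases hj : j = k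
        · subst hj; simp only [hek, h1, Pi.add_apply, Pi.single_eq_same]
        · simp [hej _ _ hj, hj]
      · rw [hek]
        intro h
        rw [h] at h1
        simp at h1
  rw [Finset.sum_add_distrib, key, ← Finset.sum_add_distrib]
  refine Finset.sum_congr rfl fun v _ => ?_
  split_ifs
  · simp
  · exact CharTwo.add_self_eq_zero _

/-- Kuhn's cubical version of Sperner's lemma: the number of fully labelled simplices in the
Freudenthal triangulation of a cubical grid is odd. -/
theorem sum_rainbow_kuhnVertex (m : ℕ) : ∀ (N : ℕ) (L : (Fin N → ℕ) → ℕ)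
    (_ : ∀ v, (∀ j, v j ≤ m + 1) → L v ≤ N)
    (_ : ∀ v, (∀ j, v j ≤ m + 1) → ∀ k : Fin N, v k = 0 → L v ≠ k)
    (_ : ∀ v, (∀ j, v j ≤ m + 1) → ∀ k : Fin N, v k = m + 1 → L v ≤ k),
    ∑ v : Fin N → Fin (m + 1), ∑ σ,
      rainbow (fun l => L (kuhnVertex (fun j => (v j : ℕ)) σ l)) = 1
  | 0, L, hN, _, _ => by
    have h0 : ∀ v, L v = 0 := fun v => Nat.le_zero.1 (hN v (fun j => j.elim0))
    simp [rainbow, h0]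
  | M + 1, L, hN, hz, hm => by
    have hle : ∀ (v : Fin (M + 1) → Fin (m + 1)) σ l j,
        kuhnVertex (fun j => (v j : ℕ)) σ l j ≤ m + 1 := by
      intro v σ l j
      have := (v j).2
      simp only [kuhnVertex]
      split_ifs <;> omega
    have step1 : ∀ v : Fin (M + 1) → Fin (m + 1),
        ∑ σ, rainbow (fun l => L (kuhnVertex (fun j => (v j : ℕ)) σ l)) =
        ∑ σ : Equiv.Perm (Fin (M + 1)),
          (rainbowFacet (fun l => L (kuhnVertex (fun j => (v j : ℕ)) σ l)) 0 +
          rainbowFacet (fun l => L (kuhnVertex ((fun j => (v j : ℕ)) + Pi.single (σ.symm 0) 1)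
            σ l)) 0) := by
      intro v
      have h1 : ∀ σ, rainbow (fun l => L (kuhnVertex (fun j => (v j : ℕ)) σ l)) =
          ∑ i, rainbowFacet (fun l => L (kuhnVertex (fun j => (v j : ℕ)) σ l)) i :=
        fun σ => rainbow_eq_sum_rainbowFacet _ fun i => hN _ (hle v σ i)
      simp only [h1]
      rw [Finset.sum_comm, Fin.sum_univ_succ, Fin.sum_univ_castSucc,
        Finset.sum_eq_zero (s := (Finset.univ : Finset (Fin M))), zero_add,
        Finset.sum_add_distrib]
      · congr 1
        exact Fintype.sum_equiv (Equiv.mulLeft (finRotate (M + 1))) _ _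
          fun σ => rainbowFacet_last_eq L _ _
      · intro i _
        apply sum_rainbowFacet_interior
        · simp
        · simp
    rw [Fintype.sum_congr _ _ step1, Finset.sum_comm]
    -- On a face `v k = m + 1` the label `M + 1` is missing; on a face `v k = 0` with `k ≠ 0` the
    -- required label `k` is missing. Only the face where coordinate `0` vanishes can contribute.
    have hfacet : ∀ (σ : Equiv.Perm (Fin (M + 1))) (v : Fin (M + 1) → ℕ),
        (∀ j, j ≠ σ.symm 0 → v j ≤ m) →
        (v (σ.symm 0) = m + 1 ∨ v (σ.symm 0) = 0 ∧ σ.symm 0 ≠ 0) →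
        rainbowFacet (fun l => L (kuhnVertex v σ l)) 0 = 0 := by
      intro σ v hv hk
      have hconst : ∀ l, l ≠ 0 → kuhnVertex v σ l (σ.symm 0) = v (σ.symm 0) := by
        intro l hl
        simp [kuhnVertex, hl]
      have hle' : ∀ l, l ≠ 0 → ∀ j, kuhnVertex v σ l j ≤ m + 1 := by
        intro l hl j
        by_cases hj : j = σ.symm 0
        · rw [hj, hconst l hl]
          omega
        · have := hv j hj
          simp only [kuhnVertex]
          split_ifs <;> omega
      rw [rainbowFacet, if_neg]
      intro h
      rcases hk with hk | ⟨hk, hk0⟩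
      · obtain ⟨l, hl, h⟩ := h (M + 1) (by omega) le_rfl
        have := hm _ (hle' l hl) (σ.symm 0) ((hconst l hl).trans hk)
        omega
      · obtain ⟨l, hl, h⟩ := h (σ.symm 0)
          (Nat.one_le_iff_ne_zero.2 fun h => hk0 (Fin.ext h)) (σ.symm 0).2.le
        exact hz _ (hle' l hl) (σ.symm 0) ((hconst l hl).trans hk) h
    have step2 : ∀ σ : Equiv.Perm (Fin (M + 1)),
        ∑ v : Fin (M + 1) → Fin (m + 1),
          (rainbowFacet (fun l => L (kuhnVertex (fun j => (v j : ℕ)) σ l)) 0 +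
          rainbowFacet (fun l => L (kuhnVertex ((fun j => (v j : ℕ)) + Pi.single (σ.symm 0) 1)
            σ l)) 0) =
        if σ 0 = 0 then ∑ w : Fin M → Fin (m + 1),
          rainbowFacet (fun l => L (kuhnVertex (Fin.cons 0 fun j => (w j : ℕ)) σ l)) 0 else 0 := by
      intro σ
      rw [sum_add_shift (σ.symm 0) (fun v => rainbowFacet (fun l => L (kuhnVertex v σ l)) 0)
        fun v h1 h2 => hfacet σ v h2 (Or.inl h1)]
      split_ifs with h0
      · have h0' : σ.symm 0 = 0 := by rw [Equiv.symm_apply_eq, h0]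
        rw [h0', ← (Fin.consEquiv fun _ => Fin (m + 1)).sum_comp, Fintype.sum_prod_type,
          Finset.sum_comm]
        refine Finset.sum_congr rfl fun w _ => ?_
        rw [Finset.sum_eq_single 0]
        · simp only [Fin.consEquiv_apply, Fin.cons_zero, if_true]
          congr! 4 with l
          funext j
          refine Fin.cases ?_ (fun j => ?_) j <;> simp
        · intro b _ hb
          simp [hb]
        · simp
      · apply Finset.sum_eq_zero
        intro v _
        split_ifs with hv
        · apply hfacet σ _ (fun j _ => Nat.le_of_lt_succ (v j).2)
          refine Or.inr ⟨by simp [hv], fun h => h0 ?_⟩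
          rw [← Equiv.eq_symm_apply, h]
        · rfl
    rw [Fintype.sum_congr _ _ step2, ← Equiv.Perm.decomposeFin.symm.sum_comp,
      Fintype.sum_prod_type, Finset.sum_eq_single 0]
    · simp only [Equiv.Perm.decomposeFin_symm_apply_zero, if_true]
      rw [Finset.sum_comm]
      have hcons : ∀ w : Fin M → ℕ, (∀ j, w j ≤ m + 1) →
          ∀ j, (Fin.cons 0 w : Fin (M + 1) → ℕ) j ≤ m + 1 := by
        intro w hw j
        refine Fin.cases ?_ (fun j => ?_) j
        · simp
        · simpa using hw j
      have hpos : ∀ w : Fin M → ℕ, (∀ j, w j ≤ m + 1) → L (Fin.cons 0 w) ≠ 0 := by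
        intro w hw
        exact hz _ (hcons w hw) 0 rfl
      -- On the remaining face label `0` does not occur, so lowering all labels by one gives an
      -- admissible labelling in dimension `M`.
      rw [← sum_rainbow_kuhnVertex m M (fun w => L (Fin.cons 0 w) - 1)]
      · refine Finset.sum_congr rfl fun w _ => Finset.sum_congr rfl fun e _ => ?_
        have hv : ∀ l : Fin (M + 1), kuhnVertex (Fin.cons 0 fun j => (w j : ℕ))
            (Equiv.Perm.decomposeFin.symm (0, e)) l.succ =
            Fin.cons 0 (kuhnVertex (fun j => (w j : ℕ)) e l) := by
          intro l
          funext j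
          refine Fin.cases ?_ (fun j => ?_) j
          · simp [kuhnVertex]
          · simp [kuhnVertex]
        have hw : ∀ l, ∀ j, kuhnVertex (fun j => (w j : ℕ)) e l j ≤ m + 1 := by
          intro l j
          have := (w j).2
          simp only [kuhnVertex]
          split_ifs <;> omega
        unfold rainbowFacet rainbow
        congr 1
        apply propext
        constructor
        · intro h j hj
          obtain ⟨l, hl, h⟩ := h (j + 1) (by omega) (by omega)
          obtain ⟨l, rfl⟩ := Fin.exists_succ_eq.2 hl
          refine ⟨l, ?_⟩
          simp only [hv] at h ⊢
          omega
        · intro h j h1 hj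
          obtain ⟨l, h⟩ := h (j - 1) (by omega)
          refine ⟨l.succ, Fin.succ_ne_zero _, ?_⟩
          simp only [hv] at h ⊢
          have := hpos _ (hw l)
          omega
      · intro w hw
        have := hN _ (hcons w hw)
        omega
      · intro w hw k hk
        have h1 := hz _ (hcons w hw) k.succ (by simpa using hk)
        have h2 := hpos w hw
        rw [Fin.val_succ] at h1
        omega
      · intro w hw k hk
        have h1 := hm _ (hcons w hw) k.succ (by simpa using hk)
        rw [Fin.val_succ] at h1
        omega
    · intro p _ hp
      apply Finset.sum_eq_zero
      intro e _
      rw [if_neg]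
      simpa using hp
    · simp

/-- Kuhn's cubical version of Sperner's lemma: some cell of a labelled cubical grid has vertices
of all labels. -/
theorem exists_rainbow_cell {m N : ℕ} (hm : 0 < m) (L : (Fin N → ℕ) → ℕ)
    (hN : ∀ v, (∀ j, v j ≤ m) → L v ≤ N)
    (h0 : ∀ v, (∀ j, v j ≤ m) → ∀ k : Fin N, v k = 0 → L v ≠ k)
    (h1 : ∀ v, (∀ j, v j ≤ m) → ∀ k : Fin N, v k = m → L v ≤ k) :
    ∃ v : Fin N → ℕ, (∀ j, v j < m) ∧ ∀ i ≤ N, ∃ x : Fin N → ℕ,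
      (∀ j, v j ≤ x j ∧ x j ≤ v j + 1) ∧ L x = i := by
  obtain ⟨m, rfl⟩ := Nat.exists_eq_add_one.2 hm
  have h := sum_rainbow_kuhnVertex m N L hN h0 h1
  obtain ⟨v, -, hv⟩ := Finset.exists_ne_zero_of_sum_ne_zero (h.trans_ne one_ne_zero)
  obtain ⟨σ, -, hσ⟩ := Finset.exists_ne_zero_of_sum_ne_zero hv
  refine ⟨fun j => v j, fun j => (v j).2, fun i hi => ?_⟩
  obtain ⟨l, hl⟩ := (ite_ne_right_iff.1 hσ).1 i hi
  refine ⟨_, fun j => ?_, hl⟩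
  simp only [kuhnVertex]
  split_ifs <;> omega

/-- A cubical version of the Knaster–Kuratowski–Mazurkiewicz lemma. -/
theorem exists_mem_iInter_of_closed_cover_cube {N : ℕ} (F : Fin (N + 1) → Set (Fin N → ℝ))
    (hF : ∀ i, IsClosed (F i)) (hcov : Set.Icc 0 1 ⊆ ⋃ i, F i)
    (h0 : ∀ t ∈ Set.Icc (0 : Fin N → ℝ) 1, ∀ k, t k = 0 → t ∉ F k.castSucc)
    (h1 : ∀ t ∈ Set.Icc (0 : Fin N → ℝ) 1, ∀ k, t k = 1 → ∀ i, t ∈ F i → i ≤ k.castSucc) :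
    ∃ t ∈ Set.Icc (0 : Fin N → ℝ) 1, ∀ i, t ∈ F i := by
  classical
  by_contra! hno
  obtain ⟨δ, hδ, hball⟩ := lebesgue_number_lemma_of_metric (s := Set.Icc (0 : Fin N → ℝ) 1)
    (c := fun i => (F i)ᶜ) isCompact_Icc (fun i => (hF i).isOpen_compl) (by
      intro t ht
      obtain ⟨i, hi⟩ := hno t ht
      exact Set.mem_iUnion.2 ⟨i, hi⟩)
  obtain ⟨n, hn⟩ := exists_nat_one_div_lt hδ
  set m := n + 1 with hm
  have hm0 : (0 : ℝ) < m := by positivity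
  let pt : (Fin N → ℕ) → (Fin N → ℝ) := fun v j => v j / m
  have hpt : ∀ v : Fin N → ℕ, (∀ j, v j ≤ m) → pt v ∈ Set.Icc (0 : Fin N → ℝ) 1 := by
    intro v hv
    refine ⟨fun j => by simp only [pt, Pi.zero_apply]; positivity, fun j => ?_⟩
    simp only [pt, Pi.one_apply]
    rw [div_le_one hm0]
    exact_mod_cast hv j
  have hlab : ∀ v : Fin N → ℕ, ∃ i : Fin (N + 1), (∀ j, v j ≤ m) → pt v ∈ F i := by
    intro v
    by_cases hv : ∀ j, v j ≤ m
    · obtain ⟨i, hi⟩ := Set.mem_iUnion.1 (hcov (hpt v hv))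
      exact ⟨i, fun _ => hi⟩
    · exact ⟨0, fun h => absurd h hv⟩
  choose L hL using hlab
  obtain ⟨v, hv, hx⟩ := exists_rainbow_cell (m := m) (by omega) (fun v => (L v : ℕ))
    (fun v _ => Nat.le_of_lt_succ (L v).2)
    (fun v hv k hk h => h0 _ (hpt v hv) k (by simp [pt, hk])
      (by rw [← show L v = k.castSucc from Fin.ext h]; exact hL v hv))
    (fun v hv k hk => h1 _ (hpt v hv) k (by simp [pt, hk, hm0.ne']) (L v) (hL v hv))
  -- The mesh is below the Lebesgue number `δ`, so the whole fully labelled cell misses a single `F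
  -- i`, yet one of its vertices has label `i`.
  obtain ⟨i, hi⟩ := hball (pt v) (hpt v fun j => (hv j).le)
  obtain ⟨x, hvx, hxi⟩ := hx i (Nat.le_of_lt_succ i.2)
  refine hi ?_ (show pt x ∈ F i by
    rw [← show L x = i from Fin.ext hxi]
    exact hL x fun j => by have := hvx j; have := hv j; omega)
  rw [Metric.mem_ball]
  refine lt_of_le_of_lt ((dist_pi_le_iff (by positivity : (0 : ℝ) ≤ 1 / (m : ℝ))).2 fun j => ?_)
    (by simpa [hm] using hn)
  obtain ⟨ha, hb⟩ := hvx j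
  have ha' : (v j : ℝ) ≤ x j := by exact_mod_cast ha
  have hb' : (x j : ℝ) ≤ v j + 1 := by exact_mod_cast hb
  simp only [pt]
  rw [Real.dist_eq, ← sub_div, abs_div, abs_of_nonneg (sub_nonneg.2 ha'), abs_of_pos hm0]
  gcongr
  linarith

end Sperner

/-! ### Singular simplices parametrized by cubes. -/

section IteratedJoin

variable {X : Type*}

/-- The map of a cube obtained by joining points successively. -/
def iteratedJoin (J : X → X → ℝ → X) : (N : ℕ) → (Fin (N + 1) → X) → (Fin N → ℝ) → X
  | 0, p, _ => p 0
  | N + 1, p, t => J (iteratedJoin J N (Fin.tail p) (Fin.tail t)) (p 0) (t 0)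

theorem continuous_iteratedJoin [TopologicalSpace X] {J : X → X → ℝ → X}
    (hJ : Continuous fun p : X × X × ℝ => J p.1 p.2.1 p.2.2) :
    ∀ (N : ℕ) (p : Fin (N + 1) → X), Continuous (iteratedJoin J N p)
  | 0, _ => continuous_const
  | N + 1, p => by
    have h1 : Continuous fun t : Fin (N + 1) → ℝ => iteratedJoin J N (Fin.tail p) (Fin.tail t) :=
      (continuous_iteratedJoin hJ N (Fin.tail p)).comp
        (continuous_pi fun j => continuous_apply j.succ)
    exact hJ.comp (h1.prodMk (continuous_const.prodMk (continuous_apply 0)))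

theorem iteratedJoin_mem {J : X → X → ℝ → X} {A : Set X}
    (hA : ∀ x ∈ A, ∀ y ∈ A, ∀ s, J x y s ∈ A) :
    ∀ (N : ℕ) (p : Fin (N + 1) → X) (t : Fin N → ℝ), (∀ i, p i ∈ A) → iteratedJoin J N p t ∈ A
  | 0, _, _, hp => hp 0
  | N + 1, _, _, hp => hA _ (iteratedJoin_mem hA N _ _ fun i => hp i.succ) _ (hp 0) _

/-- At parameter `0` the `k`-th join returns the join of the later points, so `p k` is never used.
-/
theorem iteratedJoin_mem_of_eq_zero {J : X → X → ℝ → X} (hJ : ∀ x y, J x y 0 = x) {A : Set X}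
    (hA : ∀ x ∈ A, ∀ y ∈ A, ∀ s, J x y s ∈ A) :
    ∀ (N : ℕ) (p : Fin (N + 1) → X) (t : Fin N → ℝ) (k : Fin N), t k = 0 →
      (∀ i, i ≠ k.castSucc → p i ∈ A) → iteratedJoin J N p t ∈ A
  | 0, _, _, k, _, _ => k.elim0
  | N + 1, p, t, k, hk, hp => by
    refine Fin.cases (fun hk hp => ?_) (fun k hk hp => ?_) k hk hp
    · rw [iteratedJoin, hk, hJ]
      exact iteratedJoin_mem hA N _ _ fun i => hp _ (Fin.succ_ne_zero i)
    · refine hA _ (iteratedJoin_mem_of_eq_zero hJ hA N _ _ k hk fun i hi => hp _ ?_) _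
        (hp 0 ?_) _
      · rw [← Fin.succ_castSucc]
        exact fun h => hi (Fin.succ_injective _ h)
      · rw [← Fin.succ_castSucc]
        exact (Fin.succ_ne_zero _).symm

/-- At parameter `1` the `k`-th join returns `p k`, discarding all later points. -/
theorem iteratedJoin_mem_of_eq_one {J : X → X → ℝ → X} (hJ : ∀ x y, J x y 1 = y) {A : Set X}
    (hA : ∀ x ∈ A, ∀ y ∈ A, ∀ s, J x y s ∈ A) :
    ∀ (N : ℕ) (p : Fin (N + 1) → X) (t : Fin N → ℝ) (k : Fin N), t k = 1 →
      (∀ i, i ≤ k.castSucc → p i ∈ A) → iteratedJoin J N p t ∈ A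
  | 0, _, _, k, _, _ => k.elim0
  | N + 1, p, t, k, hk, hp => by
    refine Fin.cases (fun hk hp => ?_) (fun k hk hp => ?_) k hk hp
    · rw [iteratedJoin, hk, hJ]
      exact hp 0 le_rfl
    · refine hA _ (iteratedJoin_mem_of_eq_one hJ hA N _ _ k hk fun i hi => hp _ ?_) _
        (hp 0 (Fin.zero_le _)) _
      rw [← Fin.succ_castSucc]
      exact Fin.succ_le_succ_iff.2 hi

end IteratedJoin

/-! ### Covering dimension, continuous joins and Helly's theorem. -/

section Joins

variable {X : Type*} [MetricSpace X]

theorem hasRefinements_of_compactTopDim_le {n : ℕ}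
    (h : compactTopDim X ≤ ((n : ℕ∞) : WithBot ℕ∞)) {K : Set X} (hK : IsCompact K) :
    HasRefinementsOfMultiplicityLE K (n + 1) := by
  have h1 : coveringDim K < (((n + 1 : ℕ) : ℕ∞) : WithBot ℕ∞) := by
    refine lt_of_le_of_lt ((le_iSup₂ (f := fun (K : Set X) (_ : IsCompact K) => coveringDim K)
      K hK).trans h) ?_
    exact_mod_cast Nat.lt_succ_self n
  obtain ⟨d, hd, hdn⟩ := sInf_lt_iff.1 h1
  exact hd _ hdn

/-- Closed sets which, along the faces of a cube mapped to a space, are met as in the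
Knaster–Kuratowski–Mazurkiewicz lemma have a common point if the image of the cube has small
covering dimension. -/
theorem nonempty_iInter_of_hasRefinements {N k : ℕ} (hk : k ≤ N) {g : (Fin N → ℝ) → X}
    (hg : Continuous g) (hdim : HasRefinementsOfMultiplicityLE (g '' Set.Icc 0 1) k)
    {C : Fin (N + 1) → Set X} (hC : ∀ i, IsClosed (C i))
    (h0 : ∀ t ∈ Set.Icc (0 : Fin N → ℝ) 1, ∀ k, t k = 0 → g t ∈ C k.castSucc)
    (h1 : ∀ t ∈ Set.Icc (0 : Fin N → ℝ) 1, ∀ k, t k = 1 → ∀ i, k.castSucc < i → g t ∈ C i) :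
    (⋂ i, C i).Nonempty := by
  classical
  by_contra hemp
  have hKc : IsCompact (g '' Set.Icc 0 1) := isCompact_Icc.image hg
  set K := g '' Set.Icc (0 : Fin N → ℝ) 1 with hK
  have hgK : ∀ t ∈ Set.Icc (0 : Fin N → ℝ) 1, g t ∈ K := fun t ht => Set.mem_image_of_mem g ht
  obtain ⟨V, hVo, hVc, hVr, hVm⟩ := hdim
    (Set.range fun i => ((Subtype.val ⁻¹' C i : Set K))ᶜ)
    (by
      rintro _ ⟨i, rfl⟩
      exact ((hC i).preimage continuous_subtype_val).isOpen_compl)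
    (by
      rw [Set.eq_univ_iff_forall]
      intro y
      by_contra hy
      refine hemp ⟨y, Set.mem_iInter.2 fun i => ?_⟩
      by_contra hi
      exact hy (Set.mem_sUnion.2 ⟨_, ⟨i, rfl⟩, hi⟩))
  have hc : ∀ v : V, ∃ i, (v : Set K) ⊆ (Subtype.val ⁻¹' C i : Set K)ᶜ := by
    intro v
    obtain ⟨_, ⟨i, rfl⟩, hi⟩ := hVr v v.2
    exact ⟨i, hi⟩
  choose c hc using hc
  -- Each member of `V` is put in one class only, so a point common to all the `W i` lies in `N + 1`
  -- distinct members of `V`.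
  let W : Fin (N + 1) → Set K := fun i => ⋃ (v : V) (_ : c v = i), (v : Set K)
  have hWC : ∀ i, ∀ y ∈ W i, (y : X) ∉ C i := by
    intro i y hy
    obtain ⟨v, rfl, hv⟩ := by simpa only [W, Set.mem_iUnion, exists_prop] using hy
    exact hc v hv
  have : CompactSpace K := isCompact_iff_compactSpace.1 hKc
  obtain ⟨F, hFc, hF, hFW⟩ := exists_iUnion_eq_closed_subset (u := W)
    (fun i => isOpen_iUnion fun v => isOpen_iUnion fun _ => hVo v v.2)
    (fun _ => Set.toFinite _) (by
      rw [Set.eq_univ_iff_forall]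
      intro y
      obtain ⟨v, hv, hy⟩ := Set.mem_sUnion.1 (hVc.symm ▸ Set.mem_univ y : y ∈ ⋃₀ V)
      exact Set.mem_iUnion.2 ⟨c ⟨v, hv⟩, Set.mem_iUnion₂.2 ⟨⟨v, hv⟩, rfl, hy⟩⟩)
  have hnot : ∀ i t, g t ∈ C i → g t ∉ Subtype.val '' F i := by
    rintro i t ht ⟨y, hy, hyt⟩
    exact hWC i y (hFW i hy) (hyt ▸ ht)
  obtain ⟨t, ht, htF⟩ := exists_mem_iInter_of_closed_cover_cube
    (fun i => g ⁻¹' (Subtype.val '' F i))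
    (fun i => ((hKc.isClosed.isClosedEmbedding_subtypeVal.isClosedMap _ (hF i)).preimage hg))
    (by
      intro t ht
      have : (⟨g t, hgK t ht⟩ : K) ∈ ⋃ i, F i := hFc ▸ Set.mem_univ _
      obtain ⟨i, hi⟩ := Set.mem_iUnion.1 this
      exact Set.mem_iUnion.2 ⟨i, _, hi, rfl⟩)
    (fun t ht k hk => hnot _ _ (h0 t ht k hk))
    (fun t ht k hk i hi => not_lt.1 fun hlt => hnot _ _ (h1 t ht k hk i hlt) hi)
  have hv : ∀ i, ∃ v : V, c v = i ∧ (⟨g t, hgK t ht⟩ : K) ∈ (v : Set K) := by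
    intro i
    obtain ⟨y, hy, hyt⟩ := htF i
    have hy' := hFW i hy
    rw [show y = ⟨g t, hgK t ht⟩ from Subtype.ext hyt] at hy'
    simpa only [W, Set.mem_iUnion, exists_prop] using hy'
  choose v hcv hv using hv
  have hinj : Function.Injective fun i => (v i : Set K) := by
    intro i j hij
    rw [← hcv i, ← hcv j, Subtype.ext hij]
  have hcard := (Set.encard_le_encard (s := Set.range fun i => (v i : Set K)) (by
    rintro _ ⟨i, rfl⟩
    exact ⟨(v i).2, hv i⟩)).trans (hVm ⟨g t, hgK t ht⟩)
  rw [← Set.image_univ, hinj.encard_image, Set.encard_univ, ENat.card_eq_coe_fintype_card,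
    Fintype.card_fin, Nat.cast_le] at hcard
  omega

theorem IsSegment.symm {x y : X} {S : Set X} (h : IsSegment x y S) : IsSegment y x S := by
  obtain ⟨l, hl, γ, hγ, h0, h1, rfl⟩ := h
  refine ⟨l, hl, fun s => γ (l - s), fun s hs t ht => ?_, by simpa using h1, by simpa using h0, ?_⟩
  · rw [hγ _ ⟨by linarith [hs.2], by linarith [hs.1]⟩ _ ⟨by linarith [ht.2], by linarith [ht.1]⟩,
      abs_sub_comm]
    congr 1
    ring
  · rw [← Set.image_image γ (fun s => l - s)]
    simp

theorem IsSegment.left_mem {x y : X} {S : Set X} (h : IsSegment x y S) : x ∈ S := by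
  obtain ⟨l, hl, γ, hγ, h0, h1, rfl⟩ := h
  exact ⟨0, ⟨le_rfl, hl⟩, h0⟩

/-- Distance from the endpoint `x` is an isometric coordinate on the segment; in particular it
determines a point of it. -/
theorem IsSegment.dist_eq {x y : X} {S : Set X} (h : IsSegment x y S) {z w : X} (hz : z ∈ S)
    (hw : w ∈ S) : dist z w = |dist x z - dist x w| := by
  obtain ⟨l, hl, γ, hγ, rfl, rfl, rfl⟩ := h
  obtain ⟨s, hs, rfl⟩ := hz
  obtain ⟨t, ht, rfl⟩ := hw
  have h0 : (0 : ℝ) ∈ Set.Icc 0 l := ⟨le_rfl, hl⟩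
  rw [hγ _ hs _ ht, hγ _ h0 _ hs, hγ _ h0 _ ht, zero_sub, zero_sub, abs_neg, abs_neg,
    abs_of_nonneg hs.1, abs_of_nonneg ht.1]

theorem IsSegment.exists_dist_eq {x y : X} {S : Set X} (h : IsSegment x y S) {u : ℝ} (h0 : 0 ≤ u)
    (h1 : u ≤ 1) : ∃ z ∈ S, dist x z = u * dist x y := by
  obtain ⟨l, hl, γ, hγ, rfl, rfl, rfl⟩ := h
  have h0l : (0 : ℝ) ∈ Set.Icc 0 l := ⟨le_rfl, hl⟩
  have hu : u * l ∈ Set.Icc 0 l := ⟨by positivity, mul_le_of_le_one_left hl h1⟩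
  refine ⟨γ (u * l), ⟨_, hu, rfl⟩, ?_⟩
  rw [hγ _ h0l _ hu, hγ _ h0l _ ⟨hl, le_rfl⟩, zero_sub, zero_sub, abs_neg, abs_neg,
    abs_of_nonneg hu.1, abs_of_nonneg hl]

theorem IsSegment.exists_ratio {x y : X} {S : Set X} (h : IsSegment x y S) {z : X} (hz : z ∈ S) :
    ∃ u, 0 ≤ u ∧ u ≤ 1 ∧ dist x z = u * dist x y ∧ dist z y = (1 - u) * dist x y := by
  obtain ⟨l, hl, γ, hγ, rfl, rfl, rfl⟩ := h
  obtain ⟨s, hs, rfl⟩ := hz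
  have h0l : (0 : ℝ) ∈ Set.Icc 0 l := ⟨le_rfl, hl⟩
  have hl' : l ∈ Set.Icc 0 l := ⟨hl, le_rfl⟩
  rw [hγ _ h0l _ hs, hγ _ h0l _ hl', hγ _ hs _ hl', zero_sub, zero_sub, abs_neg, abs_neg,
    abs_of_nonneg hs.1, abs_of_nonneg hl, abs_sub_comm, abs_of_nonneg (sub_nonneg.2 hs.2)]
  rcases hl.eq_or_lt with rfl | hpos
  · exact ⟨0, le_rfl, zero_le_one, by linarith [hs.1, hs.2], by linarith [hs.1, hs.2]⟩
  · refine ⟨s / l, div_nonneg hs.1 hl, (div_le_one hpos).2 hs.2, ?_, ?_⟩ <;> field_simp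

theorem IsSegment.dist_le {x y : X} {S : Set X} (h : IsSegment x y S) {z : X} (hz : z ∈ S) :
    dist x z ≤ dist x y := by
  obtain ⟨u, h0, h1, h, -⟩ := h.exists_ratio hz
  rw [h]
  exact mul_le_of_le_one_left dist_nonneg h1

theorem IsSegment.isBounded {x y : X} {S : Set X} (h : IsSegment x y S) : Bornology.IsBounded S :=
  Metric.isBounded_closedBall.subset fun z hz => by
    rw [Metric.mem_closedBall, dist_comm]
    exact h.dist_le hz

/-- In a uniquely geodesic space, points can be joined continuously inside convex sets. -/
theorem IsUniquelyGeodesic.exists_join (h : IsUniquelyGeodesic X) :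
    ∃ J : X → X → ℝ → X, Continuous (fun p : X × X × ℝ => J p.1 p.2.1 p.2.2) ∧
      (∀ A, IsGeodesicallyConvex A → ∀ x ∈ A, ∀ y ∈ A, ∀ s, J x y s ∈ A) ∧
      (∀ x y, J x y 0 = x) ∧ ∀ x y, J x y 1 = y := by
  obtain ⟨seg, hseg, hcont⟩ := h
  have hS : ∀ x y, IsSegment x y (seg x y) := fun x y => (hseg x y _).2 rfl
  -- Clamping to `[0, 1]` makes the join defined and continuous for every real parameter.
  let c : ℝ → ℝ := fun s => max 0 (min 1 s)
  have hc0 : ∀ s, 0 ≤ c s := fun s => le_max_left _ _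
  have hc1 : ∀ s, c s ≤ 1 := fun s => max_le zero_le_one (min_le_left _ _)
  have hc : Continuous c := by fun_prop
  choose J hJm hJd using fun x y s => (hS x y).exists_dist_eq (hc0 s) (hc1 s)
  refine ⟨J, ?_, fun A hA x hx y hy s => hA x hx y hy _ (hS x y) (hJm x y s), ?_, ?_⟩
  · rw [continuous_iff_continuousAt]
    rintro ⟨x, y, s⟩
    have key : ∀ x' y' s', dist (J x' y' s') (J x y s) ≤
        2 * Metric.hausdorffDist (seg x' y') (seg x y) + dist x' x +
          |c s' * dist x' y' - c s * dist x y| := by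
      intro x' y' s'
      refine le_of_forall_pos_le_add fun ε hε => ?_
      -- The point is first moved to a nearby `w` on the limit segment and then along that segment,
      -- where positions are compared by their distance from `x`. The Hausdorff distance enters both
      -- moves, hence the factor `2`.
      obtain ⟨w, hw, hzw⟩ := Metric.exists_dist_lt_of_hausdorffDist_lt (hJm x' y' s')
        (lt_add_of_pos_right (Metric.hausdorffDist (seg x' y') (seg x y)) (half_pos hε))
        (Metric.hausdorffEDist_ne_top_of_nonempty_of_bounded ⟨_, (hS x' y').left_mem⟩
          ⟨_, (hS x y).left_mem⟩ (hS x' y').isBounded (hS x y).isBounded)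
      have h1 := dist_triangle (J x' y' s') w (J x y s)
      rw [(hS x y).dist_eq hw (hJm x y s), hJd] at h1
      have h2 : |dist x w - c s' * dist x' y'| ≤ dist x' x + dist (J x' y' s') w := by
        rw [← hJd, abs_le]
        have a1 := dist_triangle4 x x' (J x' y' s') w
        have a2 := dist_triangle4 x' x w (J x' y' s')
        rw [dist_comm x x'] at a1
        rw [dist_comm w] at a2
        constructor <;> linarith
      have h3 := abs_add_le (dist x w - c s' * dist x' y') (c s' * dist x' y' - c s * dist x y)
      rw [sub_add_sub_cancel] at h3
      linarith
    rw [ContinuousAt, tendsto_iff_dist_tendsto_zero]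
    refine squeeze_zero (fun _ => dist_nonneg) (fun p => key p.1 p.2.1 p.2.2) ?_
    have t1 : Tendsto (fun p : X × X × ℝ => (p.1, p.2.1)) (𝓝 (x, y, s)) (𝓝 (x, y)) :=
      Continuous.tendsto (f := fun p : X × X × ℝ => (p.1, p.2.1)) (by fun_prop) (x, y, s)
    have t2 : Tendsto (fun p : X × X × ℝ => dist p.1 x +
        |c p.2.2 * dist p.1 p.2.1 - c s * dist x y|) (𝓝 (x, y, s)) (𝓝 0) := by
      have : Continuous (fun p : X × X × ℝ => dist p.1 x +
        |c p.2.2 * dist p.1 p.2.1 - c s * dist x y|) := by fun_prop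
      simpa using this.tendsto (x, y, s)
    simpa [add_assoc] using (((hcont x y).comp t1).const_mul 2).add t2
  · intro x y
    have := hJd x y 0
    simp only [c, zero_le_one, min_eq_right, max_self, zero_mul] at this
    exact (dist_eq_zero.1 this).symm
  · intro x y
    have h1 := hJd x y 1
    simp only [c, min_self, zero_le_one, max_eq_right, one_mul] at h1
    have h2 := (hS x y).dist_eq (hJm x y 1) (hS x y).symm.left_mem
    rw [h1, sub_self, abs_zero] at h2
    exact dist_eq_zero.1 h2

theorem nonempty_iInter_of_forall_nonempty_iInter_ne (h : IsUniquelyGeodesic X) {n N : ℕ}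
    (hdim : compactTopDim X ≤ ((n : ℕ∞) : WithBot ℕ∞)) (hN : n + 1 ≤ N)
    {A : Fin (N + 1) → Set X} (hA : ∀ i, IsGeodesicallyConvex (A i))
    (hne : ∀ i, ∃ x, ∀ j, j ≠ i → x ∈ A j) : (⋂ i, A i).Nonempty := by
  obtain ⟨J, hJc, hJA, hJ0, hJ1⟩ := h.exists_join
  choose p hp using hne
  have hg := continuous_iteratedJoin hJc N p
  set g := iteratedJoin J N p
  -- The part of the cube's boundary where `p i` is not used: either its own parameter is `0`, or an
  -- earlier parameter is `1`.
  let Z : Fin (N + 1) → Set (Fin N → ℝ) := fun i => Set.Icc 0 1 ∩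
    ((⋃ (k : Fin N) (_ : k.castSucc = i), {t | t k = 0}) ∪
      ⋃ (k : Fin N) (_ : k.castSucc < i), {t | t k = 1})
  have hZ : ∀ i, IsCompact (Z i) := by
    intro i
    refine isCompact_Icc.inter_right (IsClosed.union ?_ ?_)
    · exact isClosed_iUnion_of_finite fun k => isClosed_iUnion_of_finite fun _ =>
        isClosed_eq (continuous_apply k) continuous_const
    · exact isClosed_iUnion_of_finite fun k => isClosed_iUnion_of_finite fun _ =>
        isClosed_eq (continuous_apply k) continuous_const
  have hZA : ∀ i, g '' Z i ⊆ A i := by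
    rintro i _ ⟨t, ⟨-, ht | ht⟩, rfl⟩
    · obtain ⟨k, rfl, hk⟩ := by simpa only [Set.mem_iUnion, exists_prop] using ht
      exact iteratedJoin_mem_of_eq_zero hJ0 (hJA _ (hA _)) N p t k hk fun i hi => hp i _ hi.symm
    · obtain ⟨k, hki, hk⟩ := by simpa only [Set.mem_iUnion, exists_prop] using ht
      exact iteratedJoin_mem_of_eq_one hJ1 (hJA _ (hA _)) N p t k hk
        fun j hj => hp j _ (hj.trans_lt hki).ne'
  refine (nonempty_iInter_of_hasRefinements hN hg
    (hasRefinements_of_compactTopDim_le hdim (isCompact_Icc.image hg))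
    (fun i => ((hZ i).image hg).isClosed) ?_ ?_).mono (Set.iInter_mono hZA)
  · intro t ht k hk
    exact ⟨t, ⟨ht, Or.inl (Set.mem_iUnion₂.2 ⟨k, rfl, hk⟩)⟩, rfl⟩
  · intro t ht k hk i hi
    exact ⟨t, ⟨ht, Or.inr (Set.mem_iUnion₂.2 ⟨k, hi, hk⟩)⟩, rfl⟩

/-- Helly's theorem in uniquely geodesic spaces. -/
theorem IsUniquelyGeodesic.helly (h : IsUniquelyGeodesic X) {n : ℕ}
    (hdim : compactTopDim X ≤ ((n : ℕ∞) : WithBot ℕ∞)) {ι : Type*} (A : ι → Set X)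
    (hA : ∀ i, IsGeodesicallyConvex (A i))
    (hne : ∀ J : Finset ι, J.card ≤ n + 1 → (⋂ i ∈ J, A i).Nonempty) (J : Finset ι) :
    (⋂ i ∈ J, A i).Nonempty := by
  classical
  induction hc : J.card using Nat.strong_induction_on generalizing J with
  | _ c ih =>
    rcases le_or_gt c (n + 1) with hle | hlt
    · exact hne J (hc.trans_le hle)
    · obtain ⟨N, rfl⟩ := Nat.exists_eq_add_one.2 (Nat.zero_lt_of_lt hlt)
      let e := J.equivFinOfCardEq hc
      obtain ⟨x, hx⟩ := nonempty_iInter_of_forall_nonempty_iInter_ne h hdim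
        (Nat.le_of_lt_succ hlt) (A := fun i => A (e.symm i)) (fun i => hA _) (by
          intro i
          obtain ⟨x, hx⟩ := ih N (Nat.lt_succ_self N) (J.erase (e.symm i))
            (by rw [Finset.card_erase_of_mem (e.symm i).2, hc]; rfl)
          refine ⟨x, fun j hj => Set.mem_iInter₂.1 hx _ ?_⟩
          rw [Finset.mem_erase]
          exact ⟨fun h => hj (e.symm.injective (Subtype.ext h)), (e.symm j).2⟩)
      refine ⟨x, Set.mem_iInter₂.2 fun i hi => ?_⟩
      simpa using Set.mem_iInter.1 hx (e ⟨i, hi⟩)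

end Joins

/-! ### CAT(0) spaces are uniquely geodesic. -/

section CATZero

theorem exists_comparison_triangle {a b c : ℝ} (ha : 0 ≤ a) (hb : 0 ≤ b) (hc : 0 ≤ c)
    (habc : a ≤ b + c) (hbca : b ≤ a + c) (hcab : c ≤ a + b) :
    ∃ p q r : EuclideanSpace ℝ (Fin 2), dist p q = a ∧ dist p r = b ∧ dist q r = c := by
  rcases ha.eq_or_lt with rfl | hpos
  · obtain rfl : b = c := by linarith
    refine ⟨0, 0, !₂[b, 0], by simp, ?_, ?_⟩ <;>
      simp [EuclideanSpace.dist_eq, Fin.sum_univ_two, Real.sqrt_sq_eq_abs, abs_of_nonneg hb]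
  -- With `p` at the origin and `q` on the first axis, `u` is the abscissa of `r` given by the law
  -- of cosines.
  · set u := (a ^ 2 + b ^ 2 - c ^ 2) / (2 * a) with hu
    have hua : 2 * a * u = a ^ 2 + b ^ 2 - c ^ 2 := by rw [hu]; field_simp
    have hub : u ^ 2 ≤ b ^ 2 := by
      apply sq_le_sq'
      · rw [hu, le_div_iff₀ (by positivity)]
        nlinarith
      · rw [hu, div_le_iff₀ (by positivity)]
        nlinarith [mul_nonneg (sub_nonneg.2 habc) (sub_nonneg.2 hbca)]
    have hv : √(b ^ 2 - u ^ 2) ^ 2 = b ^ 2 - u ^ 2 := Real.sq_sqrt (sub_nonneg.2 hub)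
    refine ⟨0, !₂[a, 0], !₂[u, √(b ^ 2 - u ^ 2)], ?_, ?_, ?_⟩
    · simp [EuclideanSpace.dist_eq, Fin.sum_univ_two, Real.sqrt_sq_eq_abs, abs_of_nonneg ha]
    · rw [EuclideanSpace.dist_eq, Real.sqrt_eq_iff_eq_sq (by positivity) hb]
      simp [Fin.sum_univ_two, Real.dist_eq, sq_abs, hv]
    · rw [EuclideanSpace.dist_eq, Real.sqrt_eq_iff_eq_sq (by positivity) hc]
      simp [Fin.sum_univ_two, Real.dist_eq, sq_abs, hv]
      linarith

variable {X : Type*} [MetricSpace X]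

/-- In the comparison triangle the points dividing two sides in the same ratio `u` are at distance
exactly `u` times the third side, by similarity. -/
theorem IsCATZero.dist_le_mul (h : IsCATZero X) {p q r : X} {S T : Set X} (hS : IsSegment p q S)
    (hT : IsSegment p r T) {z w : X} (hz : z ∈ S) (hw : w ∈ T) {u : ℝ} (h0 : 0 ≤ u) (h1 : u ≤ 1)
    (hzu : dist p z = u * dist p q) (hwu : dist p w = u * dist p r) :
    dist z w ≤ u * dist q r := by
  have hright : ∀ {q S z}, IsSegment p q S → z ∈ S → dist p z = u * dist p q →
      dist z q = (1 - u) * dist p q := by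
    intro q S z hS hz hzu
    obtain ⟨u', -, -, h1, h2⟩ := hS.exists_ratio hz
    rw [h2, sub_mul, sub_mul, ← h1, hzu]
  obtain ⟨p', q', r', hpq, hpr, hqr⟩ := exists_comparison_triangle (dist_nonneg (x := p) (y := q))
    (dist_nonneg (x := p) (y := r)) (dist_nonneg (x := q) (y := r))
    (by rw [dist_comm q r]; exact dist_triangle _ _ _) (dist_triangle _ _ _)
    (by rw [dist_comm p q]; exact dist_triangle _ _ _)
  refine (h.2 p q r S T hS hT z hz w hw p' q' r' (AffineMap.lineMap p' q' u)
    (AffineMap.lineMap p' r' u) hpq hpr hqr ?_ ?_ ?_ ?_).trans ?_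
  · rw [dist_left_lineMap, hpq, hzu, Real.norm_of_nonneg h0]
  · rw [dist_lineMap_right, hpq, hright hS hz hzu, Real.norm_of_nonneg (sub_nonneg.2 h1)]
  · rw [dist_left_lineMap, hpr, hwu, Real.norm_of_nonneg h0]
  · rw [dist_lineMap_right, hpr, hright hT hw hwu, Real.norm_of_nonneg (sub_nonneg.2 h1)]
  · rw [← hqr, dist_eq_norm, dist_eq_norm, AffineMap.lineMap_apply_module,
      AffineMap.lineMap_apply_module, add_sub_add_left_eq_sub, ← smul_sub, norm_smul,
      Real.norm_of_nonneg h0]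

theorem IsCATZero.exists_dist_le (h : IsCATZero X) {p q r : X} {S T : Set X}
    (hS : IsSegment p q S) (hT : IsSegment p r T) {z : X} (hz : z ∈ S) :
    ∃ w ∈ T, dist z w ≤ dist q r := by
  obtain ⟨u, h0, h1, hu, -⟩ := hS.exists_ratio hz
  obtain ⟨w, hw, hwu⟩ := hT.exists_dist_eq h0 h1
  exact ⟨w, hw, (h.dist_le_mul hS hT hz hw h0 h1 hu hwu).trans
    (mul_le_of_le_one_left dist_nonneg h1)⟩

theorem IsCATZero.segment_unique (h : IsCATZero X) {p q : X} {S T : Set X}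
    (hS : IsSegment p q S) (hT : IsSegment p q T) : S = T := by
  have : ∀ {S T}, IsSegment p q S → IsSegment p q T → S ⊆ T := by
    intro S T hS hT z hz
    obtain ⟨w, hw, hzw⟩ := h.exists_dist_le hS hT hz
    rw [dist_self] at hzw
    rwa [dist_le_zero.1 hzw]
  exact (this hS hT).antisymm (this hT hS)

theorem IsCATZero.isUniquelyGeodesic (h : IsCATZero X) : IsUniquelyGeodesic X := by
  choose seg hseg using h.1
  refine ⟨seg, fun x y S => ⟨fun hS => h.segment_unique hS (hseg x y), fun hS => hS ▸ hseg x y⟩,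
    fun x y => ?_⟩
  have key : ∀ x y x' y', ∀ z ∈ seg x y, ∃ w ∈ seg x' y', dist z w ≤ dist x x' + dist y y' := by
    intro x y x' y' z hz
    -- The endpoints are moved one at a time through `seg x y'`, using a triangle with vertex `x`
    -- and then one with vertex `y'`.
    obtain ⟨w, hw, hzw⟩ := h.exists_dist_le (hseg x y) (hseg x y') hz
    obtain ⟨w', hw', hww'⟩ := h.exists_dist_le (hseg x y').symm (hseg x' y').symm hw
    exact ⟨w', hw', by linarith [dist_triangle z w w']⟩
  refine squeeze_zero (fun _ => Metric.hausdorffDist_nonneg)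
    (g := fun p : X × X => dist p.1 x + dist p.2 y) (fun p => ?_) ?_
  · refine Metric.hausdorffDist_le_of_mem_dist (by positivity) (key _ _ _ _) fun z hz => ?_
    rw [dist_comm p.1, dist_comm p.2]
    exact key _ _ _ _ z hz
  · have : Continuous fun p : X × X => dist p.1 x + dist p.2 y := by fun_prop
    simpa using this.tendsto (x, y)

end CATZero

end Helly

theorem theorem1 {X : Type*} [MetricSpace X] :
    (Helly.IsUniquelyGeodesic X →
      ∀ n : ℕ, Helly.compactTopDim X = ((n : ℕ∞) : WithBot ℕ∞) →
      ∀ (m : ℕ) (A : Fin m → Set X), (∀ i, Helly.IsGeodesicallyConvex (A i)) →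
        (∀ J : Finset (Fin m), J.card ≤ n + 1 → (⋂ i ∈ J, A i).Nonempty) →
        (⋂ i, A i).Nonempty) ∧
    (Helly.IsCATZero X → Helly.IsUniquelyGeodesic X) := by
  refine ⟨fun h n hdim m A hA hne => ?_, fun h => h.isUniquelyGeodesic⟩
  simpa using h.helly hdim.le A hA hne Finset.univ
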